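/- **Road network.** Let $V$ be a finite set of nodes. A road is a sequence of distinct nodes, and is one-way or two-way. A road $r$ traverses $(u,v)$ if $u,v$ are consecutive (in this order) in $r$, or if $r$ is two-way and $v,u$ are consecutive in $r$. Let $R$ be a set of roads such that every node lies on some road and every pair $(u,v)$ is traversed by at most one road of $R$. The pairs traversed by roads of $R$ are the edges of a directed graph; $R(u,v)$ denotes the unique road traversing the edge $(u,v)$, and every edge has a length $L(u,v)>0$. The turn cost $C(r,r')$ is $0$ if $r=r'$ and $1$ otherwise. A route from $s$ to $t$ is a sequence $\rho=(n_0=s,n_1,\dots,n_k=t)$ of nodes, $k\ge 0$, repetitions allowed, in which any two consecutive nodes form an edge. Put $$L(\rho)=\sum_{i=0}^{k-1}L(n_i,n_{i+1}),\qquad C(\rho)=\sum_{i=1}^{k-1}C\big(R(n_{i-1},n_i),R(n_i,n_{i+1})\big).$$ A route from $s$ to $t$ is *fastest* (*simplest*) if its length (complexity) is the smallest among all routes from $s$ to $t$. It is *near-fastest* for $\varepsilon\ge 0$ if its length is at most $1+\varepsilon$ times that of a fastest route, and *simplest near-fastest* if it has the lowest complexity among all near-fastest routes from $s$ to $t$.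 For a node $n$ let $sfL[n], sfC[n]$ be the length and complexity of the simplest among the fastest routes from $n$ to $t$, and $fsL[n], fsC[n]$ those of the fastest among the simplest routes from $n$ to $t$ (all are $\infty$ if $t$ cannot be reached from $n$). **Algorithm SNF-A\*** (input: the network, $s$, $t$, $\varepsilon$, and the four arrays). Let $B=(1+\varepsilon)\,sfL[s]$. 1. If $fsL[s]\le B$, return $(fsL[s],fsC[s])$; the reported route is any fastest simplest route from $s$ to $t$. 2. Otherwise set $(snfL^+,snfC^+)\gets(sfL[s],sfC[s])$ and enheap the label $\langle s\mid 0,0,\varnothing\rangle$. Labels are $\langle n\mid len,cpl,n_{prev}\rangle$; a node may have several labels; $\Lambda(n)$ is the set of all labels of $n$ that were enheaped and not removed (deheaped ones included). 3. While the heap is not empty, deheap a label $\langle n_x\mid len,cpl,n_w\rangle$ whose key $(len+fsL[n_x],\,cpl+fsC[n_x])$ is minimal, comparing second components first and first components in case of a tie (remaining ties are broken arbitrarily). - If $n_x=t$, set $(snfL^+,snfC^+)\gets(len,cpl)$ and leave the loop. - Otherwise, for every edge $(n_x,n_y)$, in any order, form $\lambda=\langle n_y\mid len',cpl',n_x\rangle$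 with $len'=len+L(n_x,n_y)$ and $cpl'=cpl+C(R(n_w,n_x),R(n_x,n_y))$ (no turn cost if $n_w=\varnothing$). For labels of the same node write $\lambda_1\prec\lambda_2$ if $len_1<len_2$ and $cpl_1+1<cpl_2$. Remove from $\Lambda(n_y)$ and from the heap all $\lambda'$ with $\lambda\prec\lambda'$. If no $\lambda'\in\Lambda(n_y)$ satisfies $\lambda'\prec\lambda$, and $len'+sfL[n_y]\le B$, and $cpl'+fsC[n_y]<snfC^+$, then: if moreover $len'+fsL[n_y]\le B$, set $(snfL^+,snfC^+)\gets(len'+fsL[n_y],\,cpl'+1+fsC[n_y])$; in either case enheap $\lambda$ and add it to $\Lambda(n_y)$. 4. Return $(snfL^+,snfC^+)$. The reported route is obtained by backtracking from the label that caused the last assignment of this pair, followed by an arbitrary fastest simplest route from the node of that label to $t$ (by nothing if that label was a deheaped label of $t$); if the pair was never changed after step 2, it is an arbitrary simplest fastest route from $s$ to $t$. **Theorem.** Suppose that $t$ can be reached from $s$, and let $\varepsilon\ge0$. Then, however ties are broken and edges are ordered, SNF-A\* terminates; at least one route can be reported; and every route that can be reported is a simplest near-fastest route from $s$ to $t$ whose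 length and complexity are the returned pair. -/

import Mathlib

open scoped NNReal ENNReal

/-- A road `r` (a sequence of nodes) is driven from `u` directly to `v`: either `u, v` are
consecutive in `r`, or `r` is a two-way road and `v, u` are consecutive in `r`. -/
def Traverses {V : Type*} (twoWay : Set (List V)) (r : List V) (u v : V) : Prop :=
  [u, v] <:+: r ∨ (r ∈ twoWay ∧ [v, u] <:+: r)

/-- A road network: a set of roads (sequences of distinct nodes) covering all nodes, no two of
which share a road segment, together with positive lengths of the road segments. -/
structure RoadNetwork (V : Type*) where
  roads : Set (List V)
  /-- The roads that can be driven in both directions (the others are one-way). -/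
  twoWay : Set (List V)
  nodup : ∀ r ∈ roads, r.Nodup
  cover : ∀ n : V, ∃ r ∈ roads, n ∈ r
  unique : ∀ r ∈ roads, ∀ r' ∈ roads, ∀ u v : V,
    Traverses twoWay r u v → Traverses twoWay r' u v → r = r'
  /-- The length function; only its values on edges matter. -/
  length : V → V → ℝ≥0
  length_pos : ∀ r ∈ roads, ∀ u v : V, Traverses twoWay r u v → 0 < length u v

namespace RoadNetwork

variable {V : Type*}

/-- The edges of the directed graph of the network. -/
def Edge (N : RoadNetwork V) (u v : V) : Prop :=
  ∃ r ∈ N.roads, Traverses N.twoWay r u v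

open Classical in
/-- The unique road containing the edge `(u, v)` (the empty list if `(u, v)` is not an edge). -/
noncomputable def roadOf (N : RoadNetwork V) (u v : V) : List V :=
  if h : N.Edge u v then h.choose else []

theorem roadOf_spec (N : RoadNetwork V) {u v : V} (h : N.Edge u v) :
    N.roadOf u v ∈ N.roads ∧ Traverses N.twoWay (N.roadOf u v) u v := by
  rw [roadOf, dif_pos h]
  exact h.choose_spec

theorem roadOf_eq (N : RoadNetwork V) {u v : V} {r : List V} (hr : r ∈ N.roads)
    (h : Traverses N.twoWay r u v) : N.roadOf u v = r :=
  N.unique _ (N.roadOf_spec ⟨r, hr, h⟩).1 _ hr u v (N.roadOf_spec ⟨r, hr, h⟩).2 h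

open Classical in
/-- The cost of going from road `r` to road `r'` at a node: every change of road costs `1`, staying
on the same road is free. -/
noncomputable def turnCost (r r' : List V) : ℕ :=
  if r = r' then 0 else 1

/-- The cost of the turn made at `x` when coming from `w` and going on to `y`. -/
noncomputable def turn (N : RoadNetwork V) (w x y : V) : ℕ :=
  turnCost (N.roadOf w x) (N.roadOf x y)

/-- `ρ` is a route from `s` to `t`. -/
def IsRoute (N : RoadNetwork V) (s t : V) (ρ : List V) : Prop :=
  ρ.head? = some s ∧ ρ.getLast? = some t ∧ ρ.IsChain N.Edge

/-- The length of a route: the sum of the lengths of its edges. -/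
def routeLength (N : RoadNetwork V) : List V → ℝ≥0
  | a :: b :: l => N.length a b + routeLength N (b :: l)
  | _ => 0

/-- The complexity of a route: the sum of the turn costs over its consecutive triples. -/
noncomputable def complexity (N : RoadNetwork V) : List V → ℕ
  | a :: b :: c :: l => N.turn a b c + complexity N (b :: c :: l)
  | _ => 0

def IsFastest (N : RoadNetwork V) (s t : V) (ρ : List V) : Prop :=
  N.IsRoute s t ρ ∧ ∀ ρ', N.IsRoute s t ρ' → N.routeLength ρ ≤ N.routeLength ρ'

def IsSimplest (N : RoadNetwork V) (s t : V) (ρ : List V) : Prop :=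
  N.IsRoute s t ρ ∧ ∀ ρ', N.IsRoute s t ρ' → N.complexity ρ ≤ N.complexity ρ'

def IsFastestSimplest (N : RoadNetwork V) (s t : V) (ρ : List V) : Prop :=
  N.IsSimplest s t ρ ∧ ∀ ρ', N.IsSimplest s t ρ' → N.routeLength ρ ≤ N.routeLength ρ'

def IsSimplestFastest (N : RoadNetwork V) (s t : V) (ρ : List V) : Prop :=
  N.IsFastest s t ρ ∧ ∀ ρ', N.IsFastest s t ρ' → N.complexity ρ ≤ N.complexity ρ'

/-- The length is at most `1 + ε` times that of a fastest route. -/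
def IsNearFastest (N : RoadNetwork V) (ε : ℝ≥0) (s t : V) (ρ : List V) : Prop :=
  N.IsRoute s t ρ ∧
    ∃ ρ₀, N.IsFastest s t ρ₀ ∧ N.routeLength ρ ≤ (1 + ε) * N.routeLength ρ₀

def IsSimplestNearFastest (N : RoadNetwork V) (ε : ℝ≥0) (s t : V) (ρ : List V) : Prop :=
  N.IsNearFastest ε s t ρ ∧
    ∀ ρ', N.IsNearFastest ε s t ρ' → N.complexity ρ ≤ N.complexity ρ'

/-! ### The arrays of costs to the target

All fastest simplest routes from `n` to `t` have the same length and complexity, and likewise all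
simplest fastest ones, so the infima below are just these common values; they are `⊤` when `t`
cannot be reached from `n`. -/

/-- `sfL[n]`: the length of the simplest fastest routes from `n` to `t`. -/
noncomputable def sfL (N : RoadNetwork V) (t n : V) : ℝ≥0∞ :=
  ⨅ (ρ : List V) (_ : N.IsSimplestFastest n t ρ), (N.routeLength ρ : ℝ≥0∞)

/-- `sfC[n]`: the complexity of the simplest fastest routes from `n` to `t`. -/
noncomputable def sfC (N : RoadNetwork V) (t n : V) : ℕ∞ :=
  ⨅ (ρ : List V) (_ : N.IsSimplestFastest n t ρ), (N.complexity ρ : ℕ∞)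

/-- `fsL[n]`: the length of the fastest simplest routes from `n` to `t`. -/
noncomputable def fsL (N : RoadNetwork V) (t n : V) : ℝ≥0∞ :=
  ⨅ (ρ : List V) (_ : N.IsFastestSimplest n t ρ), (N.routeLength ρ : ℝ≥0∞)

/-- `fsC[n]`: the complexity of the fastest simplest routes from `n` to `t`. -/
noncomputable def fsC (N : RoadNetwork V) (t n : V) : ℕ∞ :=
  ⨅ (ρ : List V) (_ : N.IsFastestSimplest n t ρ), (N.complexity ρ : ℕ∞)

end RoadNetwork

/-! ### The algorithm SNF-A* -/

namespace SNFAStar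

variable {V : Type*}

/-- A label `⟨node | len, cpl, prev⟩` (`prev = none` for the label of the source). The field `route`
is what backtracking along the labels yields; the search itself never consults it. -/
@[ext]
structure Label (V : Type*) where
  node : V
  len : ℝ≥0
  cpl : ℕ
  prev : Option V
  route : List V

/-- A pair `(snfL⁺, snfC⁺)`, with the set of the routes that backtracking may report for it; the
search itself never consults the field `routes`. -/
@[ext]
structure Best (V : Type*) where
  snfL : ℝ≥0∞
  snfC : ℕ∞
  routes : Set (List V)

/-- The variables of the main loop: the heap, the labels (`Λ(n)` consists of the members of `labels`
with node `n`, including those that have left the heap by being deheaped), and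
`(snfL⁺, snfC⁺)`. -/
structure State (V : Type*) where
  heap : Multiset (Label V)
  labels : Set (Label V)
  best : Best V

/-- The FS-shorter order on pairs (length, complexity). -/
def FSShorter (p q : ℝ≥0∞ × ℕ∞) : Prop :=
  p.2 < q.2 ∨ (p.2 = q.2 ∧ p.1 < q.1)

/-- The key `(len + fsL[n], cpl + fsC[n])` of a heap entry. -/
noncomputable def key (N : RoadNetwork V) (t : V) (l : Label V) : ℝ≥0∞ × ℕ∞ :=
  ((l.len : ℝ≥0∞) + N.fsL t l.node, (l.cpl : ℕ∞) + N.fsC t l.node)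

/-- The dominance relation `l ≺ l'` between labels of the same node. -/
def Dominates (l l' : Label V) : Prop :=
  l.node = l'.node ∧ l.len < l'.len ∧ l.cpl + 1 < l'.cpl

/-- The label of the source. -/
def sourceLabel (s : V) : Label V :=
  { node := s, len := 0, cpl := 0, prev := none, route := [s] }

/-- The label for the extension of the route of `l` along the edge from its node to `y`. There is no
turn at the source. -/
noncomputable def extend (N : RoadNetwork V) (l : Label V) (y : V) : Label V where
  node := y
  len := l.len + N.length l.node y
  cpl := l.cpl + (match l.prev with
    | none => 0
    | some w => N.turn w l.node y)
  prev := some l.node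
  route := l.route ++ [y]

/-- The bound `(1 + ε) · sfL[s]`. -/
noncomputable def lengthBound (N : RoadNetwork V) (s t : V) (ε : ℝ≥0) : ℝ≥0∞ :=
  (1 + (ε : ℝ≥0∞)) * N.sfL t s

/-- A new label survives if it is not dominated by an existing label of its node and passes the
length test and the complexity test. -/
def Survives (N : RoadNetwork V) (s t : V) (ε : ℝ≥0) (S : State V) (l : Label V) : Prop :=
  (¬ ∃ l' ∈ S.labels, Dominates l' l) ∧
    (l.len : ℝ≥0∞) + N.sfL t l.node ≤ lengthBound N s t ε ∧
    (l.cpl : ℕ∞) + N.fsC t l.node < S.best.snfC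

open Classical in
/-- The update of `(snfL⁺, snfC⁺)` for a surviving label `l`. The routes in question are those that
follow the route of `l` and then a fastest simplest route from its node to `t`. -/
noncomputable def updateBest (N : RoadNetwork V) (s t : V) (ε : ℝ≥0) (b : Best V) (l : Label V) :
    Best V :=
  if (l.len : ℝ≥0∞) + N.fsL t l.node ≤ lengthBound N s t ε then
    { snfL := (l.len : ℝ≥0∞) + N.fsL t l.node
      snfC := (l.cpl : ℕ∞) + 1 + N.fsC t l.node
      routes := {ρ | ∃ σ, N.IsFastestSimplest l.node t σ ∧ ρ = l.route ++ σ.tail} }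
  else b

open Classical in
/-- The body of the loop over the outgoing edges, for the deheaped label `l` and its out-neighbour
`y`: the labels dominated by the new label are removed, and the new label is enheaped if it
survives. -/
noncomputable def relax (N : RoadNetwork V) (s t : V) (ε : ℝ≥0) (l : Label V) (S : State V)
    (y : V) : State V :=
  let l₁ := extend N l y
  let heap₁ := S.heap.filter (fun l' => ¬ Dominates l₁ l')
  let labels₁ := {l' ∈ S.labels | ¬ Dominates l₁ l'}
  if Survives N s t ε S l₁ then
    { heap := l₁ ::ₘ heap₁
      labels := insert l₁ labels₁
      best := updateBest N s t ε S.best l₁ }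
  else
    { heap := heap₁
      labels := labels₁
      best := S.best }

/-- A configuration of the algorithm: about to test the condition of the main loop, or finished
with the given answer. -/
inductive Config (V : Type*) where
  | running (S : State V)
  | done (answer : Best V)

open Classical in
/-- The part of the algorithm before the main loop: if a fastest simplest route is short enough, its
costs are returned; otherwise the costs of a simplest fastest route are recorded and the label of
the source is enheaped. -/
noncomputable def start (N : RoadNetwork V) (s t : V) (ε : ℝ≥0) : Config V :=
  if N.fsL t s ≤ lengthBound N s t ε then
    .done
      { snfL := N.fsL t s
        snfC := N.fsC t s
        routes := {ρ | N.IsFastestSimplest s t ρ} }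
  else
    .running
      { heap := {sourceLabel s}
        labels := {sourceLabel s}
        best :=
          { snfL := N.sfL t s
            snfC := N.sfC t s
            routes := {ρ | N.IsSimplestFastest s t ρ} } }

/-- One iteration of the main loop. The deheaped label is any heap entry with an FS-shortest key, and
the outgoing edges are processed in any order. -/
inductive Step (N : RoadNetwork V) (s t : V) (ε : ℝ≥0) : Config V → Config V → Prop
  | exhausted (S : State V) (hS : S.heap = 0) :
      Step N s t ε (.running S) (.done S.best)
  | target (S : State V) (l : Label V) (H : Multiset (Label V)) (hS : S.heap = l ::ₘ H)
      (hmin : ∀ l' ∈ S.heap, ¬ FSShorter (key N t l') (key N t l)) (hl : l.node = t) :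
      Step N s t ε (.running S)
        (.done { snfL := (l.len : ℝ≥0∞), snfC := (l.cpl : ℕ∞), routes := {l.route} })
  | expand (S : State V) (l : Label V) (H : Multiset (Label V)) (hS : S.heap = l ::ₘ H)
      (hmin : ∀ l' ∈ S.heap, ¬ FSShorter (key N t l') (key N t l)) (hl : l.node ≠ t)
      (ys : List V) (hys : ys.Nodup) (hedge : ∀ y, y ∈ ys ↔ N.Edge l.node y) :
      Step N s t ε (.running S)
        (.running (ys.foldl (relax N s t ε l) { S with heap := H }))

/-- `b` is a correct answer: at least one route is reported, and every reported route is a simplest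
near-fastest route whose length and complexity are the returned values. -/
def CorrectAnswer (N : RoadNetwork V) (s t : V) (ε : ℝ≥0) (b : Best V) : Prop :=
  b.routes.Nonempty ∧ ∀ ρ ∈ b.routes, N.IsSimplestNearFastest ε s t ρ ∧
    b.snfL = (N.routeLength ρ : ℝ≥0∞) ∧ b.snfC = (N.complexity ρ : ℕ∞)

end SNFAStar

/-! Fix a simplest near-fastest route `ρ`. A turn costs at most 1, so joining two routes costs at
most 1 beyond the sum of their complexities. If a label dominated that of a prefix of `ρ`,
exchanging the prefix would give a shorter and strictly simpler route, which is impossible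
(`IsLabel.not_dominates`). Hence the heap keeps a label of a prefix of `ρ` as long as `snfC⁺`
exceeds the complexity of `ρ` (`HasPrefix`): when such a label is expanded, its extension along `ρ`
passes every test (`hasPrefix_relax_of_isPrefix`). An empty heap therefore forces `snfC⁺` down to
the complexity of `ρ`, where the recorded upper bound (`Acceptable`) is exact.

The delicate exit is through a label of `t`, which may have been enheaped before `snfC⁺` dropped;
`TargetBounded` controls it. An edge from `n` to `t` is a simplest route from `n`, so if it fits the
length bound, the label of `n` already passed the update test. As its key is minimal, `snfC⁺` is at
most one above the complexity of `ρ`, and the strict complexity test does the rest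
(`Invariant.expand`).

Termination: edge lengths are bounded below, so label routes have boundedly many nodes, and each
expansion replaces a heap entry by finitely many entries with longer routes. -/

namespace RoadNetwork

variable {V : Type*}

/-! ### Splitting and joining routes -/

theorem IsRoute.exists_eq_cons {N : RoadNetwork V} {n t : V} {σ : List V}
    (h : N.IsRoute n t σ) : ∃ τ, σ = n :: τ := by
  obtain ⟨h, -, -⟩ := h
  cases σ with
  | nil => simp at h
  | cons a τ => exact ⟨τ, by simpa using h⟩

theorem IsRoute.append {N : RoadNetwork V} {s n t : V} {π τ : List V}
    (h : N.IsRoute s n (π ++ [n])) (h' : N.IsRoute n t (n :: τ)) :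
    N.IsRoute s t (π ++ n :: τ) := by
  refine ⟨?_, ?_, List.isChain_split.2 ⟨h.2.2, h'.2.2⟩⟩
  · have := h.1
    cases π <;> simpa using this
  · have := h'.2.1
    rw [List.getLast?_append, this]
    rfl

theorem IsRoute.of_append {N : RoadNetwork V} {s n t : V} {π τ : List V}
    (h : N.IsRoute s t (π ++ n :: τ)) : N.IsRoute n t (n :: τ) := by
  refine ⟨rfl, ?_, (List.isChain_split.1 h.2.2).2⟩
  have := h.2.1
  rw [List.getLast?_append_of_ne_nil _ (by simp)] at this
  exact this

theorem IsRoute.edge {N : RoadNetwork V} {u v : V} (h : N.Edge u v) : N.IsRoute u v [u, v] :=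
  ⟨rfl, rfl, by simpa using h⟩

theorem routeLength_append (N : RoadNetwork V) (π : List V) (n : V) (τ : List V) :
    N.routeLength (π ++ n :: τ) = N.routeLength (π ++ [n]) + N.routeLength (n :: τ) := by
  induction π with
  | nil => simp [routeLength]
  | cons a π ih =>
    cases π with
    | nil => simp [routeLength]
    | cons b π =>
      simp only [List.cons_append, routeLength] at ih ⊢
      rw [ih, add_assoc]

theorem turn_le_one (N : RoadNetwork V) (w x y : V) : N.turn w x y ≤ 1 := by
  unfold turn turnCost
  split_ifs <;> simp

/-- Cutting at `n` loses at most the turn made there, whose cost is nonnegative. -/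
theorem complexity_add_le (N : RoadNetwork V) (π : List V) (n : V) (τ : List V) :
    N.complexity (π ++ [n]) + N.complexity (n :: τ) ≤ N.complexity (π ++ n :: τ) := by
  induction π with
  | nil => simp [complexity]
  | cons a π ih =>
    rcases π with _ | ⟨b, _ | ⟨c, π⟩⟩
    · cases τ <;> simp [complexity]
    · simp only [List.cons_append, List.nil_append, complexity] at ih ⊢
      lia
    · simp only [List.cons_append, complexity] at ih ⊢
      lia

/-- The only new turn is the one at `n`. This is the source of the `+ 1` in the dominance relation
and in the update of `snfC⁺`. -/
theorem complexity_append_le (N : RoadNetwork V) (π : List V) (n : V) (τ : List V) :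
    N.complexity (π ++ n :: τ) ≤ N.complexity (π ++ [n]) + 1 + N.complexity (n :: τ) := by
  induction π with
  | nil => simp
  | cons a π ih =>
    rcases π with _ | ⟨b, _ | ⟨c, π⟩⟩
    · cases τ with
      | nil => simp [complexity]
      | cons c τ =>
        have := N.turn_le_one a n c
        simp only [List.cons_append, List.nil_append, complexity]
        lia
    · simp only [List.cons_append, List.nil_append, complexity] at ih ⊢
      lia
    · simp only [List.cons_append, complexity] at ih ⊢
      lia

theorem complexity_append_triple (N : RoadNetwork V) (π : List V) (w n y : V) :
    N.complexity (π ++ [w, n, y]) = N.complexity (π ++ [w, n]) + N.turn w n y := by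
  induction π with
  | nil => simp [complexity]
  | cons a π ih =>
    rcases π with _ | ⟨b, _ | ⟨c, π⟩⟩
    · simp [complexity]
    · simp only [List.cons_append, List.nil_append, complexity] at ih ⊢
      lia
    · simp only [List.cons_append, complexity] at ih ⊢
      lia

/-! ### Finiteness and existence of optimal routes -/

/-- The edges of a finite network are bounded away from `0`. -/
theorem exists_pos_le_length [Finite V] (N : RoadNetwork V) :
    ∃ δ : ℝ≥0, 0 < δ ∧ ∀ u v, N.Edge u v → δ ≤ N.length u v := by
  by_cases h : {p : V × V | N.Edge p.1 p.2}.Nonempty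
  · obtain ⟨p, ⟨r, hr, hp⟩, hmin⟩ :=
      Set.exists_min_image _ (fun p => N.length p.1 p.2) (Set.toFinite _) h
    exact ⟨_, N.length_pos r hr _ _ hp, fun u v huv => hmin (u, v) huv⟩
  · exact ⟨1, one_pos, fun u v huv => (h ⟨(u, v), huv⟩).elim⟩

theorem length_mul_le {N : RoadNetwork V} {δ : ℝ≥0} (hδ : ∀ u v, N.Edge u v → δ ≤ N.length u v)
    (ρ : List V) (hρ : ρ.IsChain N.Edge) : ρ.length * δ ≤ N.routeLength ρ + δ := by
  induction ρ with
  | nil => simp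
  | cons a ρ ih =>
    cases ρ with
    | nil => simp [routeLength]
    | cons b ρ =>
      rw [List.isChain_cons_cons] at hρ
      have h₁ := hδ _ _ hρ.1
      have h₂ := ih hρ.2
      rw [List.length_cons, Nat.cast_succ, add_mul, one_mul]
      calc _ ≤ N.routeLength (b :: ρ) + δ + N.length a b := by gcongr
        _ = _ := by rw [routeLength]; ring

/-- In a finite network, routes of bounded length have boundedly many nodes. -/
theorem exists_length_le [Finite V] (N : RoadNetwork V) (M : ℝ≥0) :
    ∃ K : ℕ, ∀ ρ : List V, ρ.IsChain N.Edge → N.routeLength ρ ≤ M → ρ.length ≤ K := by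
  obtain ⟨δ, hδ, h⟩ := N.exists_pos_le_length
  refine ⟨⌈(M + δ) / δ⌉₊, fun ρ hρ hM => ?_⟩
  have : (ρ.length : ℝ≥0) ≤ (M + δ) / δ := by
    rw [le_div_iff₀ hδ]
    exact (length_mul_le h ρ hρ).trans (by gcongr)
  exact_mod_cast this.trans (Nat.le_ceil _)

/-- A nonempty set of routes has a shortest member. -/
theorem exists_shortest [Finite V] (N : RoadNetwork V) {P : List V → Prop}
    (hP : ∀ ρ, P ρ → ρ.IsChain N.Edge) (h : ∃ ρ, P ρ) :
    ∃ ρ, P ρ ∧ ∀ ρ', P ρ' → N.routeLength ρ ≤ N.routeLength ρ' := by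
  obtain ⟨ρ₀, h₀⟩ := h
  obtain ⟨K, hK⟩ := N.exists_length_le (N.routeLength ρ₀)
  have hfin : {ρ | P ρ ∧ N.routeLength ρ ≤ N.routeLength ρ₀}.Finite :=
    (List.finite_length_le V K).subset fun ρ hρ => hK ρ (hP ρ hρ.1) hρ.2
  obtain ⟨ρ, hρ, hmin⟩ := Set.exists_min_image _ N.routeLength hfin ⟨ρ₀, h₀, le_rfl⟩
  refine ⟨ρ, hρ.1, fun ρ' h' => ?_⟩
  rcases le_total (N.routeLength ρ') (N.routeLength ρ₀) with hle | hle
  · exact hmin ρ' ⟨h', hle⟩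
  · exact hρ.2.trans hle

/-- A nonempty set of routes has a member of lowest complexity. -/
theorem exists_simplest (N : RoadNetwork V) {P : List V → Prop} (h : ∃ ρ, P ρ) :
    ∃ ρ, P ρ ∧ ∀ ρ', P ρ' → N.complexity ρ ≤ N.complexity ρ' := by
  obtain ⟨ρ₀, h₀⟩ := h
  exact ⟨_, Function.argminOn_mem N.complexity {ρ | P ρ} ⟨ρ₀, h₀⟩,
    fun ρ' h' => Function.argminOn_le N.complexity {ρ | P ρ} h'⟩

theorem exists_isFastestSimplest [Finite V] (N : RoadNetwork V) {n t : V}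
    (h : ∃ ρ, N.IsRoute n t ρ) : ∃ ρ, N.IsFastestSimplest n t ρ :=
  N.exists_shortest (P := N.IsSimplest n t) (fun _ h => h.1.2.2) (N.exists_simplest h)

theorem exists_isSimplestFastest [Finite V] (N : RoadNetwork V) {n t : V}
    (h : ∃ ρ, N.IsRoute n t ρ) : ∃ ρ, N.IsSimplestFastest n t ρ :=
  N.exists_simplest (P := N.IsFastest n t)
    (N.exists_shortest (P := N.IsRoute n t) (fun _ h => h.2.2) h)

/-! ### Values of the four arrays -/

theorem IsSimplestFastest.sfL_eq {N : RoadNetwork V} {n t : V} {ρ : List V}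
    (h : N.IsSimplestFastest n t ρ) : N.sfL t n = N.routeLength ρ :=
  le_antisymm (iInf₂_le ρ h)
    (le_iInf₂ fun ρ' h' => ENNReal.coe_le_coe.2 (h.1.2 ρ' h'.1.1))

theorem IsSimplestFastest.sfC_eq {N : RoadNetwork V} {n t : V} {ρ : List V}
    (h : N.IsSimplestFastest n t ρ) : N.sfC t n = N.complexity ρ :=
  le_antisymm (iInf₂_le ρ h) (le_iInf₂ fun ρ' h' => Nat.cast_le.2 (h.2 ρ' h'.1))

theorem IsFastestSimplest.fsL_eq {N : RoadNetwork V} {n t : V} {ρ : List V}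
    (h : N.IsFastestSimplest n t ρ) : N.fsL t n = N.routeLength ρ :=
  le_antisymm (iInf₂_le ρ h) (le_iInf₂ fun ρ' h' => ENNReal.coe_le_coe.2 (h.2 ρ' h'.1))

theorem IsFastestSimplest.fsC_eq {N : RoadNetwork V} {n t : V} {ρ : List V}
    (h : N.IsFastestSimplest n t ρ) : N.fsC t n = N.complexity ρ :=
  le_antisymm (iInf₂_le ρ h) (le_iInf₂ fun ρ' h' => Nat.cast_le.2 (h.1.2 ρ' h'.1.1))

theorem IsRoute.sfL_le [Finite V] {N : RoadNetwork V} {n t : V} {σ : List V}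
    (h : N.IsRoute n t σ) : N.sfL t n ≤ N.routeLength σ := by
  obtain ⟨ρ, hρ⟩ := N.exists_isSimplestFastest ⟨σ, h⟩
  rw [hρ.sfL_eq]
  exact ENNReal.coe_le_coe.2 (hρ.1.2 σ h)

theorem IsRoute.fsC_le [Finite V] {N : RoadNetwork V} {n t : V} {σ : List V}
    (h : N.IsRoute n t σ) : N.fsC t n ≤ N.complexity σ := by
  obtain ⟨ρ, hρ⟩ := N.exists_isFastestSimplest ⟨σ, h⟩
  rw [hρ.fsC_eq]
  exact Nat.cast_le.2 (hρ.1.2 σ h)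

/-- A single edge has no turn, so it is a simplest route and competes for `fsL`. -/
theorem Edge.fsL_le [Finite V] {N : RoadNetwork V} {n t : V} (h : N.Edge n t) :
    N.fsL t n ≤ N.length n t := by
  obtain ⟨ρ, hρ⟩ := N.exists_isFastestSimplest ⟨_, IsRoute.edge h⟩
  rw [hρ.fsL_eq]
  have := hρ.2 [n, t] ⟨IsRoute.edge h, fun ρ' _ => by simp [complexity]⟩
  simpa [routeLength] using this

theorem exists_isFastestSimplest_of_fsL_ne_top {N : RoadNetwork V} {n t : V}
    (h : N.fsL t n ≠ ⊤) : ∃ ρ, N.IsFastestSimplest n t ρ := by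
  by_contra! hn
  exact h (by simp [fsL, hn])

end RoadNetwork

namespace SNFAStar

open RoadNetwork

variable {V : Type*}

/-! ### Labels as routes, and dominance -/

/-- All fastest routes have length `sfL[s]`, so near-fastness becomes the length test of the
algorithm. -/
theorem isNearFastest_iff [Finite V] {N : RoadNetwork V} {ε : ℝ≥0} {s t : V} {ρ : List V} :
    N.IsNearFastest ε s t ρ ↔
      N.IsRoute s t ρ ∧ (N.routeLength ρ : ℝ≥0∞) ≤ lengthBound N s t ε := by
  refine and_congr_right fun hρ => ?_
  obtain ⟨ρ₁, h₁⟩ := N.exists_isSimplestFastest ⟨ρ, hρ⟩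
  have hB : lengthBound N s t ε = ((1 + ε) * N.routeLength ρ₁ : ℝ≥0) := by
    rw [lengthBound, h₁.sfL_eq]
    push_cast
    rfl
  rw [hB, ENNReal.coe_le_coe]
  refine ⟨fun ⟨ρ₀, h₀, hle⟩ => hle.trans ?_, fun h => ⟨ρ₁, h₁.1, h⟩⟩
  gcongr
  exact h₀.2 _ h₁.1.1

/-- The data of the label are those of the route obtained by backtracking. -/
def IsLabel (N : RoadNetwork V) (s : V) (l : Label V) : Prop :=
  ∃ π : List V, l.route = π ++ [l.node] ∧ N.IsRoute s l.node l.route ∧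
    l.len = N.routeLength l.route ∧ l.cpl = N.complexity l.route ∧ l.prev = π.getLast?

theorem isLabel_sourceLabel (N : RoadNetwork V) (s : V) : IsLabel N s (sourceLabel s) :=
  ⟨[], rfl, ⟨rfl, rfl, List.isChain_singleton s⟩, rfl, rfl, rfl⟩

theorem IsLabel.extend {N : RoadNetwork V} {s y : V} {l : Label V} (hl : IsLabel N s l)
    (hy : N.Edge l.node y) : IsLabel N s (extend N l y) := by
  obtain ⟨π, hπ, hroute, hlen, hcpl, hprev⟩ := hl
  have happ : l.route ++ [y] = π ++ l.node :: [y] := by simp [hπ]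
  refine ⟨l.route, rfl, ?_, ?_, ?_, ?_⟩
  · change N.IsRoute s y (l.route ++ [y])
    rw [happ]
    exact (hπ ▸ hroute).append (IsRoute.edge hy)
  · change l.len + N.length l.node y = N.routeLength (l.route ++ [y])
    rw [happ, routeLength_append, hlen, hπ]
    simp [routeLength]
  -- An empty `π` means `prev = none`, where no turn is charged; otherwise the last node of `π` is
  -- `prev`, and extending adds exactly one turn.
  · rcases List.eq_nil_or_concat π with rfl | ⟨π', w, rfl⟩
    · simp_all [SNFAStar.extend, complexity]
    · have := N.complexity_append_triple π' w l.node y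
      simp_all [SNFAStar.extend]
  · simp [SNFAStar.extend, hπ]

/-- The route of a label that is a prefix of a route `ρ` to `t` continues with a route from the node
of the label to `t`. -/
theorem IsLabel.exists_suffix {N : RoadNetwork V} {s t : V} {l : Label V} {ρ : List V}
    (hl : IsLabel N s l) (hρ : N.IsRoute s t ρ) (hp : l.route <+: ρ) :
    ∃ τ, ρ = l.route ++ τ ∧ N.IsRoute l.node t (l.node :: τ) ∧
      N.routeLength ρ = l.len + N.routeLength (l.node :: τ) ∧
      l.cpl + N.complexity (l.node :: τ) ≤ N.complexity ρ := by
  obtain ⟨τ, rfl⟩ := hp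
  obtain ⟨π, hπ, -, hlen, hcpl, -⟩ := hl
  have happ : l.route ++ τ = π ++ l.node :: τ := by simp [hπ]
  refine ⟨τ, rfl, (happ ▸ hρ).of_append, ?_, ?_⟩
  · rw [happ, routeLength_append, hlen, hπ]
  · rw [happ, hcpl, hπ]
    exact complexity_add_le ..

theorem IsLabel.append {N : RoadNetwork V} {s t : V} {l : Label V} {τ : List V}
    (hl : IsLabel N s l) (hτ : N.IsRoute l.node t (l.node :: τ)) :
    N.IsRoute s t (l.route ++ τ) ∧
      N.routeLength (l.route ++ τ) = l.len + N.routeLength (l.node :: τ) ∧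
      N.complexity (l.route ++ τ) ≤ l.cpl + 1 + N.complexity (l.node :: τ) := by
  obtain ⟨π, hπ, hroute, hlen, hcpl, -⟩ := hl
  have happ : l.route ++ τ = π ++ l.node :: τ := by simp [hπ]
  refine ⟨?_, ?_, ?_⟩
  · rw [happ]
    exact (hπ ▸ hroute).append hτ
  · rw [happ, routeLength_append, hlen, hπ]
  · rw [happ, hcpl, hπ]
    exact complexity_append_le ..

/-- Prefixes of simplest near-fastest routes are not dominated. -/
theorem IsLabel.not_dominates [Finite V] {N : RoadNetwork V} {s t : V} {ε : ℝ≥0} {l l' : Label V}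
    {ρ : List V} (hρ : N.IsSimplestNearFastest ε s t ρ) (hl : IsLabel N s l)
    (hl' : IsLabel N s l') (hp : l'.route <+: ρ) : ¬ Dominates l l' := by
  rintro ⟨hnode, hlen, hcpl⟩
  obtain ⟨hroute, hle⟩ := isNearFastest_iff.1 hρ.1
  obtain ⟨τ, -, hτ, hL, hC⟩ := hl'.exists_suffix hroute hp
  rw [← hnode] at hτ hL hC
  obtain ⟨h₁, h₂, h₃⟩ := hl.append hτ
  -- Exchange argument: the route of `l` followed by the rest of `ρ` is no longer than `ρ`, and its
  -- complexity is at most `l.cpl + 1` plus that of the rest, hence below that of `ρ`.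
  have := hρ.2 _ (isNearFastest_iff.2 ⟨h₁, le_trans (ENNReal.coe_le_coe.2 ?_) hle⟩)
  · lia
  · rw [h₂, hL]
    gcongr

/-! ### Soundness of the recorded pair -/

/-- All routes reported for `b` are near-fastest, of length `b.snfL` and of complexity at most
`b.snfC`. -/
def Acceptable (N : RoadNetwork V) (s t : V) (ε : ℝ≥0) (b : Best V) : Prop :=
  b.routes.Nonempty ∧ ∀ ρ ∈ b.routes, N.IsNearFastest ε s t ρ ∧
    b.snfL = (N.routeLength ρ : ℝ≥0∞) ∧ (N.complexity ρ : ℕ∞) ≤ b.snfC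

/-- The complexity of a reported route is at most `b.snfC`, which is at most the optimum, which is
at most the complexity of that route: all three agree. -/
theorem Acceptable.correctAnswer {N : RoadNetwork V} {s t : V} {ε : ℝ≥0} {b : Best V}
    {ρ : List V} (hρ : N.IsSimplestNearFastest ε s t ρ) (hb : Acceptable N s t ε b)
    (hle : b.snfC ≤ N.complexity ρ) : CorrectAnswer N s t ε b := by
  refine ⟨hb.1, fun ρ' h' => ?_⟩
  obtain ⟨hnf, hL, hC⟩ := hb.2 ρ' h'
  have h₁ : N.complexity ρ' ≤ N.complexity ρ := Nat.cast_le.1 (hC.trans hle)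
  refine ⟨⟨hnf, fun σ hσ => h₁.trans (hρ.2 σ hσ)⟩, hL, le_antisymm (hle.trans ?_) hC⟩
  exact Nat.cast_le.2 (hρ.2 ρ' hnf)

/-- The part of the loop invariant that does not refer to the order of the search. -/
structure Sound (N : RoadNetwork V) (s t : V) (ε : ℝ≥0) (S : State V) : Prop where
  isLabel_heap : ∀ l ∈ S.heap, IsLabel N s l
  isLabel : ∀ l ∈ S.labels, IsLabel N s l
  len_le : ∀ l ∈ S.heap, (l.len : ℝ≥0∞) + N.sfL t l.node ≤ lengthBound N s t ε
  snfC_le : ∀ l ∈ S.heap, (l.len : ℝ≥0∞) + N.fsL t l.node ≤ lengthBound N s t ε →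
    S.best.snfC ≤ (l.cpl : ℕ∞) + 1 + N.fsC t l.node
  acceptable : Acceptable N s t ε S.best

/-! ### Relaxing one edge -/

section Relax

variable {N : RoadNetwork V} {s t y : V} {ε : ℝ≥0} {S : State V} {l l' : Label V} {ρ : List V}

theorem mem_heap_relax (h : l' ∈ (relax N s t ε l S y).heap) :
    l' ∈ S.heap ∨ l' = extend N l y ∧ Survives N s t ε S (extend N l y) := by
  classical
  unfold relax at h
  dsimp only at h
  split_ifs at h with hs
  · rcases Multiset.mem_cons.1 h with h | h
    · exact .inr ⟨h, hs⟩
    · exact .inl (Multiset.mem_filter.1 h).1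
  · exact .inl (Multiset.mem_filter.1 h).1

theorem mem_heap_relax_of_mem (h : l' ∈ S.heap) (hd : ¬ Dominates (extend N l y) l') :
    l' ∈ (relax N s t ε l S y).heap := by
  classical
  unfold relax
  dsimp only
  split_ifs
  · exact Multiset.mem_cons_of_mem (Multiset.mem_filter.2 ⟨h, hd⟩)
  · exact Multiset.mem_filter.2 ⟨h, hd⟩

theorem extend_mem_heap_relax (h : Survives N s t ε S (extend N l y)) :
    extend N l y ∈ (relax N s t ε l S y).heap := by
  unfold relax
  rw [if_pos h]
  exact Multiset.mem_cons_self ..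

theorem mem_labels_relax (h : l' ∈ (relax N s t ε l S y).labels) :
    l' ∈ S.labels ∨ l' = extend N l y := by
  unfold relax at h
  dsimp only at h
  split_ifs at h with hs
  · rcases h with h | h
    · exact .inr h
    · exact .inl h.1
  · exact .inl h.1

/-- The complexity test is strict, which leaves room for the `+ 1` of the update. -/
theorem snfC_relax_le : (relax N s t ε l S y).best.snfC ≤ S.best.snfC := by
  unfold relax updateBest
  dsimp only
  split_ifs with hs hB
  · have := hs.2.2
    simp only at this ⊢
    rw [add_right_comm]
    exact Order.add_one_le_of_lt this
  · exact le_rfl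
  · exact le_rfl

theorem snfC_relax_le_of_survives (hs : Survives N s t ε S (extend N l y))
    (hB : ((extend N l y).len : ℝ≥0∞) + N.fsL t (extend N l y).node ≤ lengthBound N s t ε) :
    (relax N s t ε l S y).best.snfC ≤
      ((extend N l y).cpl : ℕ∞) + 1 + N.fsC t (extend N l y).node := by
  unfold relax updateBest
  rw [if_pos hs, if_pos hB]

theorem Acceptable.updateBest [Finite V] {b : Best V} (hB : lengthBound N s t ε ≠ ⊤)
    (hb : Acceptable N s t ε b) (hl : IsLabel N s l) :
    Acceptable N s t ε (updateBest N s t ε b l) := by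
  unfold SNFAStar.updateBest
  split_ifs with hle
  -- Finiteness of `fsL` supplies a continuation to `t`, so the set of reported routes is nonempty.
  · have hfin : N.fsL t l.node ≠ ⊤ := fun h => hB (by simpa [h] using hle)
    obtain ⟨σ₀, h₀⟩ := exists_isFastestSimplest_of_fsL_ne_top hfin
    refine ⟨⟨_, σ₀, h₀, rfl⟩, ?_⟩
    rintro _ ⟨σ, hσ, rfl⟩
    rw [hσ.fsL_eq, hσ.fsC_eq] at *
    obtain ⟨τ, rfl⟩ := hσ.1.1.exists_eq_cons
    obtain ⟨h₁, h₂, h₃⟩ := hl.append hσ.1.1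
    simp only [List.tail_cons]
    rw [isNearFastest_iff, h₂]
    push_cast
    exact ⟨⟨h₁, hle⟩, rfl, by exact_mod_cast h₃⟩
  · exact hb

theorem Sound.relax [Finite V] (hB : lengthBound N s t ε ≠ ⊤) (hS : Sound N s t ε S)
    (hl : IsLabel N s l) (hy : N.Edge l.node y) : Sound N s t ε (relax N s t ε l S y) where
  isLabel_heap l' h := by
    rcases mem_heap_relax h with h | ⟨rfl, -⟩
    exacts [hS.isLabel_heap _ h, hl.extend hy]
  isLabel l' h := by
    rcases mem_labels_relax h with h | rfl
    exacts [hS.isLabel _ h, hl.extend hy]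
  len_le l' h := by
    rcases mem_heap_relax h with h | ⟨rfl, hs⟩
    exacts [hS.len_le _ h, hs.2.1]
  snfC_le l' h hle := by
    rcases mem_heap_relax h with h | ⟨rfl, hs⟩
    exacts [snfC_relax_le.trans (hS.snfC_le _ h hle), snfC_relax_le_of_survives hs hle]
  acceptable := by
    unfold SNFAStar.relax
    dsimp only
    split_ifs
    exacts [hS.acceptable.updateBest hB (hl.extend hy), hS.acceptable]

/-- The heap holds a label of a prefix of `ρ`, unless `snfC⁺` is at most the complexity of `ρ`. -/
def HasPrefix (N : RoadNetwork V) (ρ : List V) (S : State V) : Prop :=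
  (N.complexity ρ : ℕ∞) < S.best.snfC → ∃ l ∈ S.heap, l.route <+: ρ

theorem HasPrefix.relax [Finite V] (hρ : N.IsSimplestNearFastest ε s t ρ)
    (hS : Sound N s t ε S) (hl : IsLabel N s l) (hy : N.Edge l.node y) (h : HasPrefix N ρ S) :
    HasPrefix N ρ (relax N s t ε l S y) := by
  intro hc
  obtain ⟨l', hl', hp⟩ := h (hc.trans_le snfC_relax_le)
  exact ⟨l', mem_heap_relax_of_mem hl'
    ((hl.extend hy).not_dominates hρ (hS.isLabel_heap _ hl') hp), hp⟩

/-- The rest of `ρ` bounds `sfL` and `fsC` at the new node. So the length test follows from `ρ`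
being near-fastest, and the complexity test from `snfC⁺` exceeding the complexity of `ρ`. -/
theorem hasPrefix_relax_of_isPrefix [Finite V] (hρ : N.IsSimplestNearFastest ε s t ρ)
    (hS : Sound N s t ε S) (hl : IsLabel N s l) (hy : N.Edge l.node y)
    (hp : (extend N l y).route <+: ρ) : HasPrefix N ρ (relax N s t ε l S y) := by
  intro hc
  refine ⟨_, extend_mem_heap_relax ⟨?_, ?_, ?_⟩, hp⟩
  · rintro ⟨l', hl', hd⟩
    exact (hS.isLabel _ hl').not_dominates hρ (hl.extend hy) hp hd
  all_goals
    obtain ⟨hroute, hle⟩ := isNearFastest_iff.1 hρ.1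
    obtain ⟨τ, -, hτ, hL, hC⟩ := (hl.extend hy).exists_suffix hroute hp
  · refine le_trans ?_ hle
    rw [hL]
    push_cast
    gcongr
    exact hτ.sfL_le
  · refine lt_of_le_of_lt ?_ (hc.trans_le snfC_relax_le)
    refine le_trans ?_ (Nat.cast_le.2 hC)
    push_cast
    gcongr
    exact hτ.fsC_le

/-- The labels of the target in the heap have complexity at most `c`. -/
def TargetBounded (t : V) (c : ℕ) (S : State V) : Prop :=
  ∀ l ∈ S.heap, l.node = t → l.cpl ≤ c

theorem TargetBounded.relax {c : ℕ} (h : TargetBounded t c S)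
    (hc : y = t → (l.len : ℝ≥0∞) + N.length l.node t ≤ lengthBound N s t ε →
      S.best.snfC ≤ c + 1) :
    TargetBounded t c (relax N s t ε l S y) := by
  intro l' hl' ht
  rcases mem_heap_relax hl' with hl' | ⟨rfl, hs⟩
  · exact h _ hl' ht
  · obtain rfl : y = t := ht
    have h₁ := hs.2.2
    -- A survivor has passed the length test, so the premise of `hc` holds.
    have h₂ : (l.len : ℝ≥0∞) + N.length l.node y ≤ lengthBound N s y ε := by
      refine le_trans ?_ (le_self_add.trans hs.2.1)
      simp [extend]
    have h₃ : ((extend N l y).cpl : ℕ∞) < (c + 1 : ℕ) := by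
      push_cast
      exact (le_self_add.trans_lt h₁).trans_le (hc rfl h₂)
    exact Nat.lt_succ_iff.1 (Nat.cast_lt.1 h₃)

end Relax

/-! ### Relaxing all outgoing edges -/

section Foldl

variable {N : RoadNetwork V} {s t : V} {ε : ℝ≥0} {l : Label V} {ρ : List V}

theorem Sound.foldl [Finite V] (hB : lengthBound N s t ε ≠ ⊤) (hl : IsLabel N s l) {ys : List V}
    (hys : ∀ y ∈ ys, N.Edge l.node y) {S : State V} (hS : Sound N s t ε S) :
    Sound N s t ε (ys.foldl (SNFAStar.relax N s t ε l) S) := by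
  induction ys generalizing S with
  | nil => exact hS
  | cons y ys ih =>
    rw [List.forall_mem_cons] at hys
    exact ih hys.2 (hS.relax hB hl hys.1)

/-- The second alternative covers the case where the deheaped label was itself the prefix: the
property is then restored once the next node of `ρ` is reached. -/
theorem HasPrefix.foldl [Finite V] (hB : lengthBound N s t ε ≠ ⊤)
    (hρ : N.IsSimplestNearFastest ε s t ρ) (hl : IsLabel N s l) {ys : List V}
    (hys : ∀ y ∈ ys, N.Edge l.node y) {S : State V} (hS : Sound N s t ε S)
    (h : HasPrefix N ρ S ∨ ∃ y ∈ ys, (extend N l y).route <+: ρ) :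
    HasPrefix N ρ (ys.foldl (SNFAStar.relax N s t ε l) S) := by
  induction ys generalizing S with
  | nil => simpa using h
  | cons y ys ih =>
    rw [List.forall_mem_cons] at hys
    refine ih hys.2 (hS.relax hB hl hys.1) ?_
    rcases h with h | ⟨z, hz, hp⟩
    · exact .inl (h.relax hρ hS hl hys.1)
    · rcases List.mem_cons.1 hz with rfl | hz
      · exact .inl (hasPrefix_relax_of_isPrefix hρ hS hl hys.1 hp)
      · exact .inr ⟨z, hz, hp⟩

theorem TargetBounded.foldl {c : ℕ} {ys : List V} {S : State V} (h : TargetBounded t c S)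
    (hc : t ∈ ys → (l.len : ℝ≥0∞) + N.length l.node t ≤ lengthBound N s t ε →
      S.best.snfC ≤ c + 1) :
    TargetBounded t c (ys.foldl (SNFAStar.relax N s t ε l) S) := by
  induction ys generalizing S with
  | nil => exact h
  | cons y ys ih =>
    refine ih (h.relax fun hy => hc (by simp [hy])) fun ht hle => ?_
    exact snfC_relax_le.trans (hc (List.mem_cons_of_mem _ ht) hle)

/-- Relaxing edges only removes heap entries and adds one-edge extensions of the label. -/
theorem exists_heap_foldl_eq (ys : List V) (S : State V) :
    ∃ X Y, X ≤ S.heap ∧ (ys.foldl (relax N s t ε l) S).heap = X + Y ∧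
      ∀ l' ∈ Y, l'.route.length = l.route.length + 1 := by
  classical
  induction ys generalizing S with
  | nil => exact ⟨S.heap, 0, le_rfl, by simp, by simp⟩
  | cons y ys ih =>
    obtain ⟨X, Y, hX, heq, hY⟩ := ih (relax N s t ε l S y)
    have hle : (relax N s t ε l S y).heap ≤ {extend N l y} + S.heap := by
      unfold relax
      dsimp only
      split_ifs
      · rw [← Multiset.singleton_add]
        exact add_le_add le_rfl (Multiset.filter_le _ _)
      · exact (Multiset.filter_le _ _).trans (Multiset.le_add_left _ _)
    -- At most one copy of the new label lies in `X` beyond `S.heap`; it is moved to the second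
    -- part.
    refine ⟨X ∩ S.heap, (X - S.heap) + Y, Multiset.inter_le_right, ?_, fun l' h => ?_⟩
    · rw [List.foldl_cons, heq, ← add_assoc, add_comm (X ∩ S.heap), Multiset.sub_add_inter]
    · rcases Multiset.mem_add.1 h with h | h
      · have := Multiset.mem_of_le (Multiset.sub_le_iff_le_add.2 (hX.trans hle)) h
        rw [Multiset.mem_singleton.1 this]
        simp [extend]
      · exact hY l' h

end Foldl

/-! ### Loop invariant, termination and progress -/

/-- The loop invariant, for a simplest near-fastest route `ρ`. -/
structure Invariant (N : RoadNetwork V) (s t : V) (ε : ℝ≥0) (ρ : List V) (S : State V) :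
    Prop where
  sound : Sound N s t ε S
  hasPrefix : HasPrefix N ρ S
  targetBounded : TargetBounded t (N.complexity ρ) S

section Loop

variable {N : RoadNetwork V} {s t : V} {ε : ℝ≥0} {ρ : List V}

theorem Invariant.expand [Finite V] (hB : lengthBound N s t ε ≠ ⊤)
    (hρ : N.IsSimplestNearFastest ε s t ρ) {S : State V} (hS : Invariant N s t ε ρ S)
    {l : Label V} {H : Multiset (Label V)} (hH : S.heap = l ::ₘ H)
    (hmin : ∀ l' ∈ S.heap, ¬ FSShorter (key N t l') (key N t l)) (ht : l.node ≠ t) {ys : List V}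
    (hys : ∀ y, y ∈ ys ↔ N.Edge l.node y) :
    Invariant N s t ε ρ (ys.foldl (relax N s t ε l) { S with heap := H }) := by
  have hl : l ∈ S.heap := hH ▸ Multiset.mem_cons_self l H
  have hsub : ∀ l' ∈ H, l' ∈ S.heap := fun l' h => hH ▸ Multiset.mem_cons_of_mem h
  have hlab := hS.sound.isLabel_heap l hl
  obtain ⟨hroute, -⟩ := isNearFastest_iff.1 hρ.1
  have hS' : Sound N s t ε { S with heap := H } :=
    ⟨fun l' h => hS.sound.isLabel_heap l' (hsub l' h), hS.sound.isLabel,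
      fun l' h => hS.sound.len_le l' (hsub l' h),
      fun l' h => hS.sound.snfC_le l' (hsub l' h), hS.sound.acceptable⟩
  refine ⟨hS'.foldl hB hlab fun y => (hys y).1,
    .foldl hB hρ hlab (fun y => (hys y).1) hS' ?_,
    .foldl (fun l' h => hS.targetBounded l' (hsub l' h)) fun hty hle => ?_⟩
  · by_cases hp : l.route <+: ρ
    · right
      obtain ⟨τ, rfl, hτ, -, -⟩ := hlab.exists_suffix hroute hp
      cases τ with
      | nil => exact (ht (by simpa using hτ.2.1)).elim
      | cons y τ =>
        exact ⟨y, (hys y).2 (List.isChain_cons_cons.1 hτ.2.2).1, τ, by simp [extend]⟩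
    · left
      intro hc
      obtain ⟨l', hl', hp'⟩ := hS.hasPrefix hc
      rw [hH] at hl'
      rcases Multiset.mem_cons.1 hl' with rfl | h
      · exact (hp hp').elim
      · exact ⟨l', h, hp'⟩
  -- If `snfC⁺` is still too large, a prefix of `ρ` lies in the heap with key complexity at most
  -- that of `ρ`, so the minimal key of `l` obeys the same bound. The edge to `t` bounds `fsL` at
  -- `l.node`, so `snfC_le` applies to `l` and gives the bound with `+ 1`.
  · rcases le_or_gt S.best.snfC (N.complexity ρ) with hc | hc
    · exact hc.trans le_self_add
    · obtain ⟨l', hl', hp⟩ := hS.hasPrefix hc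
      obtain ⟨τ, -, hτ, -, hC⟩ := (hS.sound.isLabel_heap l' hl').exists_suffix hroute hp
      have h₁ : (key N t l).2 ≤ (key N t l').2 :=
        not_lt.1 fun h => hmin l' hl' (.inl h)
      have h₂ : (key N t l').2 ≤ N.complexity ρ := by
        refine le_trans ?_ (Nat.cast_le.2 hC)
        push_cast
        exact add_le_add le_rfl hτ.fsC_le
      have h₃ := hS.sound.snfC_le l hl
        (le_trans (add_le_add le_rfl ((hys t).1 hty).fsL_le) hle)
      rw [add_right_comm] at h₃
      exact h₃.trans (add_le_add (h₁.trans h₂) le_rfl)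

theorem Invariant.correctAnswer_of_target [Finite V]
    (hρ : N.IsSimplestNearFastest ε s t ρ) {S : State V} (hS : Invariant N s t ε ρ S)
    {l : Label V} (hl : l ∈ S.heap) (ht : l.node = t) :
    CorrectAnswer N s t ε { snfL := l.len, snfC := l.cpl, routes := {l.route} } := by
  obtain ⟨π, -, hroute, hlen, hcpl, -⟩ := hS.sound.isLabel_heap l hl
  have hle := le_self_add.trans (hS.sound.len_le l hl)
  refine Acceptable.correctAnswer hρ ⟨⟨_, rfl⟩, ?_⟩ (Nat.cast_le.2 (hS.targetBounded l hl ht))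
  rintro _ rfl
  exact ⟨isNearFastest_iff.2 ⟨ht ▸ hroute, hlen ▸ hle⟩, by rw [hlen], by rw [hcpl]⟩

theorem Invariant.correctAnswer_of_exhausted
    (hρ : N.IsSimplestNearFastest ε s t ρ) {S : State V} (hS : Invariant N s t ε ρ S)
    (h : S.heap = 0) : CorrectAnswer N s t ε S.best := by
  refine hS.sound.acceptable.correctAnswer hρ (not_lt.1 fun hc => ?_)
  obtain ⟨l, hl, -⟩ := hS.hasPrefix hc
  simp [h] at hl

theorem acc_done (b : Best V) : Acc (fun c' c => Step N s t ε c c') (.done b) :=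
  ⟨_, fun _ h => nomatch h⟩

/-- Every state satisfying the invariant has only finite runs: in every iteration, the multiset of
the numbers of nodes that can still be appended to the routes in the heap decreases. -/
theorem Invariant.acc [Finite V] (hB : lengthBound N s t ε ≠ ⊤)
    (hρ : N.IsSimplestNearFastest ε s t ρ) {S : State V} (hS : Invariant N s t ε ρ S) :
    Acc (fun c' c => Step N s t ε c c') (.running S) := by
  classical
  obtain ⟨K, hK⟩ := N.exists_length_le (lengthBound N s t ε).toNNReal
  have wf := InvImage.wf
    (fun S : State V => S.heap.map fun l => K + 1 - l.route.length)
    (Multiset.wellFounded_isDershowitzMannaLT (α := ℕ))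
  induction S using wf.induction with
  | _ S ih =>
  refine ⟨_, fun c hc => ?_⟩
  cases hc with
  | exhausted => exact acc_done _
  | target => exact acc_done _
  | expand _ l H hH hmin ht ys _ hys =>
    refine ih _ ?_ (hS.expand hB hρ hH hmin ht hys)
    obtain ⟨X, Y, hX, heq, hY⟩ := exists_heap_foldl_eq (N := N) (s := s) (t := t) (ε := ε) (l := l)
      ys { S with heap := H }
    have hl : l ∈ S.heap := hH ▸ Multiset.mem_cons_self l H
    obtain ⟨-, -, hroute, hlen, -⟩ := hS.sound.isLabel_heap l hl
    have hlK : l.route.length ≤ K := by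
      refine hK _ hroute.2.2 ?_
      rw [← hlen, ← ENNReal.coe_le_coe, ENNReal.coe_toNNReal hB]
      exact le_self_add.trans (hS.sound.len_le l hl)
    -- Dershowitz–Manna witnesses: `X` is kept, `Y` is new, and `l` together with the filtered
    -- entries is removed. Every new value lies below that of `l`; since `l.route` has at most `K`
    -- nodes, `K + 1` makes the truncated subtraction drop strictly.
    refine ⟨X.map fun l => K + 1 - l.route.length, Y.map fun l => K + 1 - l.route.length,
      (l ::ₘ (H - X)).map fun l => K + 1 - l.route.length, by simp, ?_, ?_, ?_⟩
    · simp only [heq, Multiset.map_add]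
    · simp only
      rw [hH, ← Multiset.map_add, Multiset.add_cons, add_tsub_cancel_of_le hX]
    · intro n hn
      obtain ⟨l', hl', rfl⟩ := Multiset.mem_map.1 hn
      refine ⟨K + 1 - l.route.length, by simp, ?_⟩
      rw [hY l' hl']
      lia

/-- A nonempty heap has an entry with an FS-shortest key. -/
theorem exists_min_key (N : RoadNetwork V) (t : V) {H : Multiset (Label V)} (h : H ≠ 0) :
    ∃ l ∈ H, ∀ l' ∈ H, ¬ FSShorter (key N t l') (key N t l) := by
  classical
  obtain ⟨l₀, h₀⟩ := Multiset.exists_mem_of_ne_zero h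
  -- The components are swapped because the FS-shorter order compares complexity first.
  obtain ⟨l, hl, hmin⟩ := H.toFinset.exists_min_image
    (fun l => toLex ((key N t l).2, (key N t l).1)) ⟨l₀, Multiset.mem_toFinset.2 h₀⟩
  refine ⟨l, Multiset.mem_toFinset.1 hl, fun l' hl' hlt => ?_⟩
  exact (hmin l' (Multiset.mem_toFinset.2 hl')).not_gt (Prod.Lex.toLex_lt_toLex.2 hlt)

theorem exists_step [Finite V] (N : RoadNetwork V) (s t : V) (ε : ℝ≥0) (S : State V) :
    ∃ c, Step N s t ε (.running S) c := by
  by_cases h : S.heap = 0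
  · exact ⟨_, .exhausted S h⟩
  obtain ⟨l, hl, hmin⟩ := exists_min_key N t h
  obtain ⟨H, hH⟩ := Multiset.exists_cons_of_mem hl
  by_cases ht : l.node = t
  · exact ⟨_, .target S l H hH hmin ht⟩
  · have hfin := Set.toFinite {y | N.Edge l.node y}
    exact ⟨_, .expand S l H hH hmin ht hfin.toFinset.toList (Finset.nodup_toList _) (by simp)⟩

theorem exists_isSimplestNearFastest [Finite V] (ε : ℝ≥0) (h : ∃ ρ, N.IsRoute s t ρ) :
    ∃ ρ, N.IsSimplestNearFastest ε s t ρ := by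
  obtain ⟨ρ, hρ⟩ := N.exists_isSimplestFastest h
  refine N.exists_simplest (P := N.IsNearFastest ε s t) ⟨ρ, hρ.1.1, ρ, hρ.1, ?_⟩
  exact le_mul_of_one_le_left' le_self_add

theorem lengthBound_ne_top [Finite V] (ε : ℝ≥0) (h : ∃ ρ, N.IsRoute s t ρ) :
    lengthBound N s t ε ≠ ⊤ := by
  obtain ⟨ρ, hρ⟩ := N.exists_isSimplestFastest h
  rw [lengthBound, hρ.sfL_eq]
  exact ENNReal.mul_ne_top (by simp) (by simp)

theorem sfL_le_lengthBound (N : RoadNetwork V) (s t : V) (ε : ℝ≥0) :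
    N.sfL t s ≤ lengthBound N s t ε :=
  le_mul_of_one_le_left' le_self_add

/-- A configuration in which the loop invariant holds or a correct answer has been returned. -/
def Good (N : RoadNetwork V) (s t : V) (ε : ℝ≥0) (ρ : List V) : Config V → Prop
  | .running S => Invariant N s t ε ρ S
  | .done b => CorrectAnswer N s t ε b

theorem Good.step [Finite V] (hB : lengthBound N s t ε ≠ ⊤)
    (hρ : N.IsSimplestNearFastest ε s t ρ) {c c' : Config V} (hc : Good N s t ε ρ c)
    (h : Step N s t ε c c') : Good N s t ε ρ c' := by
  cases h with
  | exhausted S hS => exact Invariant.correctAnswer_of_exhausted hρ hc hS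
  | target S l H hS _ hl =>
    exact Invariant.correctAnswer_of_target hρ hc (hS ▸ Multiset.mem_cons_self l H) hl
  | expand S l H hS hmin hl ys _ hys => exact Invariant.expand hB hρ hc hS hmin hl hys

theorem good_start [Finite V] (hρ : N.IsSimplestNearFastest ε s t ρ) :
    Good N s t ε ρ (start N s t ε) := by
  have hroute := hρ.1.1
  unfold start
  split_ifs with h
  · obtain ⟨σ₀, h₀⟩ := N.exists_isFastestSimplest ⟨ρ, hroute⟩
    refine ⟨⟨σ₀, h₀⟩, fun σ hσ => ?_⟩
    have hσ' : N.IsFastestSimplest s t σ := hσ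
    rw [hσ'.fsL_eq] at h
    exact ⟨⟨isNearFastest_iff.2 ⟨hσ'.1.1, h⟩, fun ρ' h' => hσ'.1.2 ρ' h'.1⟩, hσ'.fsL_eq,
      hσ'.fsC_eq⟩
  · refine ⟨⟨?_, ?_, ?_, ?_, ?_⟩, fun _ => ⟨sourceLabel s, by simp, ?_⟩, ?_⟩
    · rintro l hl
      rw [Multiset.mem_singleton.1 hl]
      exact isLabel_sourceLabel N s
    · rintro l rfl
      exact isLabel_sourceLabel N s
    · rintro l hl
      rw [Multiset.mem_singleton.1 hl]
      simpa [sourceLabel] using sfL_le_lengthBound N s t ε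
    · rintro l hl hle
      rw [Multiset.mem_singleton.1 hl] at hle
      -- The source never triggered an update, but the failed initial test makes the premise of
      -- `snfC_le` false for it.
      exact (h (by simpa [sourceLabel] using hle)).elim
    · obtain ⟨σ₀, h₀⟩ := N.exists_isSimplestFastest ⟨ρ, hroute⟩
      refine ⟨⟨σ₀, h₀⟩, fun σ hσ => ?_⟩
      have hσ' : N.IsSimplestFastest s t σ := hσ
      refine ⟨isNearFastest_iff.2 ⟨hσ'.1.1, ?_⟩, hσ'.sfL_eq, hσ'.sfC_eq.ge⟩
      rw [← hσ'.sfL_eq]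
      exact sfL_le_lengthBound N s t ε
    -- The one-node route of the source label is the initial prefix of `ρ`.
    · obtain ⟨τ, rfl⟩ := hroute.exists_eq_cons
      exact ⟨τ, rfl⟩
    · rintro l hl -
      rw [Multiset.mem_singleton.1 hl]
      exact Nat.zero_le _

end Loop

end SNFAStar

/-- SNF-A* is correct: on every network with finitely many nodes in which `t` can be reached from
`s`, every run of the algorithm is finite, and every run that cannot be continued has returned a
simplest near-fastest route from `s` to `t`. -/
theorem mainTheorem4 {V : Type*} [Finite V] (N : RoadNetwork V) (s t : V) (ε : ℝ≥0)
    (hst : ∃ ρ : List V, N.IsRoute s t ρ) :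
    Acc (fun c' c => SNFAStar.Step N s t ε c c') (SNFAStar.start N s t ε) ∧
    ∀ c : SNFAStar.Config V,
      Relation.ReflTransGen (SNFAStar.Step N s t ε) (SNFAStar.start N s t ε) c →
      (∀ c' : SNFAStar.Config V, ¬ SNFAStar.Step N s t ε c c') →
      ∃ b : SNFAStar.Best V, c = .done b ∧ SNFAStar.CorrectAnswer N s t ε b := by
  obtain ⟨ρ, hρ⟩ := SNFAStar.exists_isSimplestNearFastest ε hst
  have hB := SNFAStar.lengthBound_ne_top ε hst
  have hstart := SNFAStar.good_start hρ
  constructor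
  · revert hstart
    cases SNFAStar.start N s t ε with
    | running S => exact fun h => SNFAStar.Invariant.acc hB hρ h
    | done b => exact fun _ => SNFAStar.acc_done b
  · intro c hc hstuck
    have hgood : SNFAStar.Good N s t ε ρ c := by
      clear hstuck
      induction hc with
      | refl => exact hstart
      | tail _ h ih => exact ih.step hB hρ h
    cases c with
    | running S =>
      obtain ⟨c', h⟩ := SNFAStar.exists_step N s t ε S
      exact (hstuck c' h).elim
    | done b => exact ⟨b, rfl, hgood⟩
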